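/- There are $n\ge 1$ agents and $m$ indivisible goods. Each agent $i$ has an additive valuation $v_i$: every good $g$ has a value $v_i(\{g\})\ge 0$, and $v_i(S)=\sum_{g\in S}v_i(\{g\})$ for every set $S$ of goods. An allocation is a tuple $(X_1,\dots,X_n)$ of pairwise disjoint sets of goods; the goods outside $X_1\cup\dots\cup X_n$ are discarded. For $\alpha\in(0,1]$ the allocation is $\alpha$-EFX if $v_i(X_i)\ge\alpha\, v_i(X_j\setminus\{g\})$ for all agents $i,j$ and every good $g\in X_j$. For every constant $\varepsilon\in(0,1/2]$ there is a constant $C_\varepsilon$, depending only on $\varepsilon$, such that for all $n\ge 1$ agents, any number $m$ of goods and all additive valuations $v_1,\dots,v_n$, there is a $(1-\varepsilon)$-EFX allocation that discards at most $C_\varepsilon\sqrt{n\log n}$ goods. -/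

import Mathlib

namespace FairDivision

/-- A valuation `v`, assigning a real value to every set of goods, is additive: goods have
nonnegative value and the value of a set is the sum of the values of its members. -/
def IsAdditive {M : Type*} (v : Finset M → ℝ) : Prop :=
  (∀ g : M, 0 ≤ v {g}) ∧ ∀ S : Finset M, v S = ∑ g ∈ S, v {g}

/-- A (partial) allocation of the goods `M` to the agents `N`: pairwise disjoint bundles.
Goods that lie in no bundle are discarded. -/
structure Allocation (N M : Type*) where
  bundle : N → Finset M
  disjoint : ∀ i j : N, i ≠ j → Disjoint (bundle i) (bundle j)

/-- The goods that are given to no agent. -/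
def Allocation.discarded {N M : Type*} [Fintype N] [Fintype M] [DecidableEq M]
    (X : Allocation N M) : Finset M :=
  Finset.univ \ Finset.univ.biUnion X.bundle

/-- An agent with valuation `v` and bundle `A` `α`-envies the bundle `B`. -/
def AlphaEnvies {M : Type*} (α : ℝ) (v : Finset M → ℝ) (A B : Finset M) : Prop :=
  v A < α * v B

/-- `α`-EFX: no agent `i` `α`-envies an agent `j` after the removal of any single good from
the bundle of `j`. -/
def Allocation.IsEFX {N M : Type*} [DecidableEq M] (α : ℝ) (v : N → Finset M → ℝ)
    (X : Allocation N M) : Prop :=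
  ∀ i j : N, ∀ g ∈ X.bundle j, ¬ AlphaEnvies α (v i) (X.bundle i) (X.bundle j \ {g})

end FairDivision

/-!
Among the finitely many `(1 - ε)`-EFX allocations take one that maximizes the sum of the agents'
values for their own bundles and, subject to that, the number of allocated goods
(`IsOptimal`). Any reallocation that makes nobody worse off and somebody better off, and in which
every bundle is *safe* (nobody with her old bundle would `(1 - ε)`-envy it up to one good), is again
`(1 - ε)`-EFX and so contradicts optimality (`IsOptimal.not_improved`). This has four consequences.

* The discarded goods are not `(1 - ε)`-envied, so each agent finds at most `2 / ε` of them
  *valuable*, that is, worth more than `ε` times her bundle. By double counting,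
  at most `2 n / (ε d)` discarded goods are valuable to more than `d` agents
  (`IsOptimal.card_high_demand_le`).
* The envy graph has no cycles, so each agent is reachable in it from a source, an agent whom
  nobody envies (`IsOptimal.exists_source`).
* Adding a discarded good `g` to the bundle of a source `s` destroys the EFX property, so some agent
  *champions* `s` with `g`: she prefers a safe part of the enlarged bundle to her own bundle.
  Since she does not envy `s`, the good `g` is valuable to her (`IsOptimal.exists_champion`).
* There is no cycle of envy edges and championing edges in which the goods used by
  different agents are distinct (`IsOptimal.not_exists_improving`).

Now consider `k` discarded goods that are valuable to at most `d` agents each, and choose for each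
of them one of the agents who value it, uniformly at random. For a fixed good, the chosen agent is
reached from a source, which for each of the other goods has a champion; this champion is the chosen
representative of that other good with probability at least `1 / d`. If `k (1 - 1 / d) ^ (k - 1) < 1`,
then by the union bound there is a choice in which the source of every representative is championed
by a representative (`exists_representatives`). Following champions backwards gives a forbidden
cycle (`IsOptimal.pow_le_of_low_demand`). Hence `k = O(d log d)`, and `d ≈ √(n / log n)` gives the
bound (`IsOptimal.card_discarded_le`).
-/

namespace FairDivision

open Finset Relation

/-! ### Additive valuations -/

section Additive

variable {M : Type*} {v : Finset M → ℝ}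

lemma IsAdditive.nonneg (hv : IsAdditive v) (S : Finset M) : 0 ≤ v S := by
  rw [hv.2]
  exact Finset.sum_nonneg fun g _ => hv.1 g

lemma IsAdditive.mono (hv : IsAdditive v) {S T : Finset M} (h : S ⊆ T) : v S ≤ v T := by
  rw [hv.2 S, hv.2 T]
  exact Finset.sum_le_sum_of_subset_of_nonneg h fun g _ _ => hv.1 g

lemma IsAdditive.union_le [DecidableEq M] (hv : IsAdditive v) (S T : Finset M) :
    v (S ∪ T) ≤ v S + v T := by
  have h := Finset.sum_union_inter (s₁ := S) (s₂ := T) (f := fun g => v {g})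
  rw [← hv.2, ← hv.2, ← hv.2, ← hv.2] at h
  linarith [hv.nonneg (S ∩ T)]

lemma lt_of_alphaEnvies {α : ℝ} {A B : Finset M} (hα : α ≤ 1) (hv : IsAdditive v)
    (h : AlphaEnvies α v A B) : v A < v B := by
  unfold AlphaEnvies at h
  nlinarith [hv.nonneg B]

end Additive

/-! ### Safe bundles and optimal allocations -/

section Optimal

variable {N M : Type*} [DecidableEq M] {α : ℝ} {v : N → Finset M → ℝ} {X : Allocation N M}

/-- A set `B` of goods is safe for the allocation `X` if no agent, holding her bundle of `X`,
`α`-envies `B` after the removal of a single good. -/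
def Safe (α : ℝ) (v : N → Finset M → ℝ) (X : Allocation N M) (B : Finset M) : Prop :=
  ∀ i : N, ∀ g ∈ B, ¬ AlphaEnvies α (v i) (X.bundle i) (B \ {g})

/-- An `α`-envied set contains a safe set that is still `α`-envied: a minimal `α`-envied
subset. -/
lemma exists_safe_subset {B : Finset M} (h : ∃ i, AlphaEnvies α (v i) (X.bundle i) B) :
    ∃ Z ⊆ B, Safe α v X Z ∧ ∃ i, AlphaEnvies α (v i) (X.bundle i) Z := by
  induction B using Finset.strongInduction with
  | H B ih =>
    by_cases hs : Safe α v X B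
    · exact ⟨B, Subset.rfl, hs, h⟩
    · simp only [Safe, not_forall, not_not] at hs
      obtain ⟨i, g, hg, hi⟩ := hs
      obtain ⟨Z, hZ, hZ'⟩ := ih (B \ {g})
        (Finset.sdiff_ssubset (by simpa using hg) (by simp)) ⟨i, hi⟩
      exact ⟨Z, hZ.trans Finset.sdiff_subset, hZ'⟩

variable [Fintype N]

/-- An `α`-EFX allocation is optimal if it has maximal utilitarian welfare among all `α`-EFX
allocations and, among those of maximal welfare, allocates the most goods. -/
structure IsOptimal (α : ℝ) (v : N → Finset M → ℝ) (X : Allocation N M) : Prop where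
  efx : X.IsEFX α v
  welfare_le : ∀ Y : Allocation N M, Y.IsEFX α v →
    ∑ i, v i (Y.bundle i) ≤ ∑ i, v i (X.bundle i)
  card_le : ∀ Y : Allocation N M, Y.IsEFX α v →
    ∑ i, v i (X.bundle i) ≤ ∑ i, v i (Y.bundle i) →
      ∑ i, (Y.bundle i).card ≤ ∑ i, (X.bundle i).card

lemma IsOptimal.safe (hX : IsOptimal α v X) (j : N) : Safe α v X (X.bundle j) :=
  fun i => hX.efx i j

lemma exists_isOptimal [Finite M] (α : ℝ) (v : N → Finset M → ℝ) :
    ∃ X : Allocation N M, IsOptimal α v X := by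
  classical
  have : Fintype M := Fintype.ofFinite M
  have hfin : Finite (Allocation N M) :=
    Finite.of_injective Allocation.bundle fun X Y h => by
      cases X; cases Y; cases h; rfl
  let f : Allocation N M → ℝ ×ₗ ℕ := fun X =>
    toLex (∑ i, v i (X.bundle i), ∑ i, (X.bundle i).card)
  have hne : {X : Allocation N M | X.IsEFX α v}.Nonempty :=
    ⟨⟨fun _ => ∅, fun _ _ _ => Finset.disjoint_empty_left _⟩, fun _ _ g hg => by
      simp at hg⟩
  obtain ⟨X, hX, hmax⟩ := Set.exists_max_image _ f (Set.toFinite _) hne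
  have hle : ∀ Y : Allocation N M, Y.IsEFX α v →
      ∑ i, v i (Y.bundle i) < ∑ i, v i (X.bundle i) ∨
      ∑ i, v i (Y.bundle i) = ∑ i, v i (X.bundle i) ∧
        ∑ i, (Y.bundle i).card ≤ ∑ i, (X.bundle i).card := fun Y hY =>
    Prod.Lex.toLex_le_toLex.1 (hmax Y hY)
  refine ⟨X, hX, fun Y hY => ?_, fun Y hY h => ?_⟩
  · rcases hle Y hY with h | h
    · exact h.le
    · exact h.1.le
  · rcases hle Y hY with h' | h'
    · exact absurd h' h.not_gt
    · exact h'.2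

/-- An optimal allocation cannot be Pareto improved by an allocation into safe bundles: such an
allocation is again `α`-EFX. -/
lemma IsOptimal.not_improved (hX : IsOptimal α v X) {Y : Allocation N M}
    (hY : ∀ i, v i (X.bundle i) ≤ v i (Y.bundle i)) (hs : ∀ j, Safe α v X (Y.bundle j))
    (i : N) : ¬ v i (X.bundle i) < v i (Y.bundle i) := by
  intro hi
  have h := hX.welfare_le Y fun i j g hg => by
    have := hs j i g hg
    unfold AlphaEnvies at this ⊢
    linarith [hY i]
  exact absurd (Finset.sum_lt_sum (fun i _ => hY i) ⟨i, Finset.mem_univ i, hi⟩) h.not_gt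

variable [Fintype M]

lemma Allocation.notMem_of_mem_discarded {g : M} (hg : g ∈ X.discarded) (i : N) :
    g ∉ X.bundle i := by
  simp only [Allocation.discarded, mem_sdiff, mem_univ, mem_biUnion, true_and, not_exists] at hg
  exact hg i

/-- In an optimal allocation nobody `α`-envies the set of discarded goods; otherwise a minimal
`α`-envied set of discarded goods could replace the bundle of an agent. -/
lemma IsOptimal.not_alphaEnvies_discarded (hX : IsOptimal α v X) (hα : α ≤ 1)
    (hv : ∀ i, IsAdditive (v i)) (i : N) :
    ¬ AlphaEnvies α (v i) (X.bundle i) X.discarded := by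
  classical
  intro h
  obtain ⟨Z, hZ, hs, i, hi⟩ := exists_safe_subset ⟨i, h⟩
  have hdisj : ∀ j, Disjoint (X.bundle j) Z := fun j =>
    Finset.disjoint_left.2 fun g hg hgZ => X.notMem_of_mem_discarded (hZ hgZ) j hg
  have hlt := lt_of_alphaEnvies hα (hv i) hi
  let Y : Allocation N M := ⟨Function.update X.bundle i Z, fun a b hab => by
    by_cases ha : a = i
    · subst ha
      simpa [Function.update_of_ne hab.symm] using (hdisj b).symm
    · by_cases hb : b = i
      · subst hb
        simpa [Function.update_of_ne ha] using hdisj a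
      · simpa [Function.update_of_ne ha, Function.update_of_ne hb] using X.disjoint a b hab⟩
  refine hX.not_improved (Y := Y) (fun j => ?_) (fun j => ?_) i (by simpa [Y] using hlt)
  · by_cases hj : j = i
    · subst hj; simpa [Y] using hlt.le
    · simp [Y, Function.update_of_ne hj]
  · by_cases hj : j = i
    · subst hj; simpa [Y] using hs
    · simpa [Y, Function.update_of_ne hj] using hX.safe j

/-! ### Improving cycles and champions -/

lemma exists_iterate_mem_periodicPts {S : Type*} [Finite S] (f : S → S) (a : S) :
    ∃ p, f^[p] a ∈ Function.periodicPts f := by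
  obtain ⟨p, q, hpq, he⟩ : ∃ p q : ℕ, p < q ∧ f^[p] a = f^[q] a := by
    obtain ⟨p, q, hne, he⟩ := Finite.exists_ne_map_eq_of_infinite fun k : ℕ => f^[k] a
    rcases hne.lt_or_gt with hlt | hlt
    · exact ⟨p, q, hlt, he⟩
    · exact ⟨q, p, hlt, he.symm⟩
  refine ⟨p, Function.mk_mem_periodicPts (n := q - p) (by omega) ?_⟩
  rw [Function.IsPeriodicPt, Function.IsFixedPt, ← Function.iterate_add_apply,
    Nat.sub_add_cancel hpq.le, he]

/-- Each discarded good `g` is reserved for one agent `x g`. In an optimal allocation there is no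
nonempty set `A` of agents each of whom prefers to her own bundle some safe set that is made of the
bundle of an agent of `A` and of goods reserved for her: otherwise following these
preferences inside `A` leads to a cycle, along which the bundles could be passed on. -/
lemma IsOptimal.not_exists_improving [DecidableEq N] (hX : IsOptimal α v X) (x : M → N) (A : Set N)
    (hA : A.Nonempty)
    (h : ∀ a ∈ A, ∃ b ∈ A, ∃ Z ⊆ X.bundle b ∪ {g ∈ X.discarded | x g = a},
      v a (X.bundle a) < v a Z ∧ Safe α v X Z) : False := by
  classical
  choose! f hfA Z hZ hlt hs using h
  obtain ⟨a₀, ha₀⟩ := hA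
  -- The agents of `A` on cycles of `f`.
  let O : Set N := {a | a ∈ A ∧ a ∈ Function.periodicPts f}
  have hit : ∀ k, f^[k] a₀ ∈ A := fun k => by
    induction k with
    | zero => exact ha₀
    | succ k ih => rw [Function.iterate_succ_apply']; exact hfA _ ih
  have hO : ∃ a, a ∈ O := by
    obtain ⟨p, hp⟩ := exists_iterate_mem_periodicPts f a₀
    exact ⟨f^[p] a₀, hit p, hp⟩
  have hfO : ∀ a ∈ O, f a ∈ O := fun a ha =>
    ⟨hfA a ha.1, (Function.bijOn_periodicPts f).mapsTo ha.2⟩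
  have hinj : ∀ a ∈ O, ∀ b ∈ O, f a = f b → a = b := fun a ha b hb hab =>
    (Function.bijOn_periodicPts f).injOn ha.2 hb.2 hab
  let Y : N → Finset M := fun a => if a ∈ O then Z a else X.bundle a
  have hin : ∀ a ∈ O, ∀ b ∉ O, Disjoint (Z a) (X.bundle b) := fun a ha b hb => by
    refine Finset.disjoint_left.2 fun g hg hgb => ?_
    rcases mem_union.1 (hZ a ha.1 hg) with hg | hg
    · refine Finset.disjoint_left.1 (X.disjoint (f a) b ?_) hg hgb
      rintro rfl
      exact hb (hfO a ha)
    · exact X.notMem_of_mem_discarded (mem_filter.1 hg).1 b hgb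
  have hY : ∀ a b, a ≠ b → Disjoint (Y a) (Y b) := fun a b hab => by
    by_cases ha : a ∈ O <;> by_cases hb : b ∈ O
    · simp only [Y, if_pos ha, if_pos hb]
      refine Finset.disjoint_left.2 fun g hga hgb => ?_
      rcases mem_union.1 (hZ a ha.1 hga) with hga | hga <;>
        rcases mem_union.1 (hZ b hb.1 hgb) with hgb | hgb
      · exact Finset.disjoint_left.1 (X.disjoint _ _ fun he => hab (hinj a ha b hb he)) hga hgb
      · exact X.notMem_of_mem_discarded (mem_filter.1 hgb).1 _ hga
      · exact X.notMem_of_mem_discarded (mem_filter.1 hga).1 _ hgb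
      · exact hab ((mem_filter.1 hga).2.symm.trans (mem_filter.1 hgb).2)
    · simpa only [Y, if_pos ha, if_neg hb] using hin a ha b hb
    · simpa only [Y, if_neg ha, if_pos hb] using (hin b hb a ha).symm
    · simpa only [Y, if_neg ha, if_neg hb] using X.disjoint a b hab
  obtain ⟨a, ha⟩ := hO
  refine hX.not_improved (Y := ⟨Y, hY⟩) (fun i => ?_) (fun j => ?_) a ?_
  · by_cases hi : i ∈ O
    · simpa only [Y, if_pos hi] using (hlt i hi.1).le
    · simp only [Y, if_neg hi, le_refl]
  · by_cases hj : j ∈ O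
    · simpa only [Y, if_pos hj] using hs j hj.1
    · simpa only [Y, if_neg hj] using hX.safe j
  · simpa only [Y, if_pos ha] using hlt a ha.1

/-- The edges of the envy graph of `X`: agent `i` envies agent `j`, in the exact sense. -/
def Envy (v : N → Finset M → ℝ) (X : Allocation N M) (i j : N) : Prop :=
  v i (X.bundle i) < v i (X.bundle j)

lemma IsOptimal.wellFounded_envy (hX : IsOptimal α v X) : WellFounded (Envy v X) := by
  classical
  have hirr : ∀ a, ¬ TransGen (Envy v X) a a := fun a ha => by
    refine hX.not_exists_improving (fun _ => a) {b | TransGen (Envy v X) b a} ⟨a, ha⟩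
      fun b hb => ?_
    obtain ⟨c, hbc, hca⟩ := TransGen.head'_iff.1 hb
    refine ⟨c, ?_, X.bundle c, subset_union_left, hbc, hX.safe c⟩
    rcases reflTransGen_iff_eq_or_transGen.1 hca with rfl | h
    · exact ha
    · exact h
  have : Std.Irrefl (TransGen (Envy v X)) := ⟨hirr⟩
  exact Subrelation.wf TransGen.single
    (Finite.wellFounded_of_trans_of_irrefl (TransGen (Envy v X)))

/-- Every agent is reachable in the envy graph from an agent whom nobody envies. -/
lemma IsOptimal.exists_source (hX : IsOptimal α v X) (i : N) :
    ∃ s, (∀ j, ¬ Envy v X j s) ∧ ReflTransGen (Envy v X) s i := by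
  induction i using hX.wellFounded_envy.induction with
  | h i ih =>
    by_cases h : ∃ j, Envy v X j i
    · obtain ⟨j, hj⟩ := h
      obtain ⟨s, hs, hsj⟩ := ih j hj
      exact ⟨s, hs, hsj.tail hj⟩
    · exact ⟨i, not_exists.1 h, ReflTransGen.refl⟩

/-- Handing a discarded good `g` to an unenvied agent `s` must destroy the EFX property. The agent
`i` who obtains a minimal envied part `Z` of the enlarged bundle values `g` at more than `ε` times
her own bundle, since she does not envy `s` without `g`. -/
lemma IsOptimal.exists_champion {ε : ℝ} (hX : IsOptimal (1 - ε) v X) (hε : 0 < ε) (hε' : ε ≤ 1)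
    (hv : ∀ i, IsAdditive (v i)) {s : N} (hs : ∀ j, ¬ Envy v X j s) {g : M}
    (hg : g ∈ X.discarded) :
    ∃ i, ∃ Z ⊆ X.bundle s ∪ {g}, v i (X.bundle i) < v i Z ∧ Safe (1 - ε) v X Z ∧
      ε * v i (X.bundle i) < v i {g} := by
  classical
  have hgX := X.notMem_of_mem_discarded hg
  have key : ∃ i, AlphaEnvies (1 - ε) (v i) (X.bundle i) (X.bundle s ∪ {g}) := by
    by_contra! hno
    have hno' : Safe (1 - ε) v X (X.bundle s ∪ {g}) := fun i h _ hi => by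
      refine hno i (lt_of_lt_of_le hi ?_)
      exact mul_le_mul_of_nonneg_left ((hv i).mono sdiff_subset) (by linarith)
    let Y : Allocation N M := ⟨Function.update X.bundle s (X.bundle s ∪ {g}), fun a b hab => by
      by_cases ha : a = s
      · subst ha
        rw [Function.update_self, Function.update_of_ne hab.symm]
        exact disjoint_union_left.2 ⟨X.disjoint _ _ hab, by simpa using hgX b⟩
      · by_cases hb : b = s
        · subst hb
          rw [Function.update_self, Function.update_of_ne hab]
          exact disjoint_union_right.2 ⟨X.disjoint _ _ hab, by simpa using hgX a⟩
        · simpa [Function.update_of_ne ha, Function.update_of_ne hb] using X.disjoint a b hab⟩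
    have hsub : ∀ i, X.bundle i ⊆ Y.bundle i := fun i => by
      by_cases hi : i = s
      · subst hi; simp [Y]
      · simp [Y, Function.update_of_ne hi]
    have hle : ∀ i, v i (X.bundle i) ≤ v i (Y.bundle i) := fun i => (hv i).mono (hsub i)
    have hY : Y.IsEFX (1 - ε) v := fun i j => by
      have hsafe : Safe (1 - ε) v X (Y.bundle j) := by
        by_cases hj : j = s
        · subst hj; simpa [Y] using hno'
        · simpa [Y, Function.update_of_ne hj] using hX.safe j
      intro h hh
      have := hsafe i h hh
      unfold AlphaEnvies at this ⊢
      linarith [hle i]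
    refine absurd (hX.card_le Y hY (Finset.sum_le_sum fun i _ => hle i)) (not_le.2 ?_)
    refine Finset.sum_lt_sum (fun i _ => card_le_card (hsub i)) ⟨s, mem_univ s, ?_⟩
    simp only [Y, Function.update_self]
    rw [card_union_of_disjoint (disjoint_singleton_right.2 (hgX s)), card_singleton]
    exact Nat.lt_succ_self _
  obtain ⟨Z, hZ, hsafe, i, hi⟩ := exists_safe_subset key
  refine ⟨i, Z, hZ, lt_of_alphaEnvies (by linarith) (hv i) hi, hsafe, ?_⟩
  have h1 := ((hv i).mono hZ).trans ((hv i).union_le _ _)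
  have h2 := not_lt.1 (hs i)
  unfold AlphaEnvies at hi
  -- If `g` were worth at most `ε * v i (X i)`, then `(1 - ε) * v i Z ≤ (1 - ε ^ 2) * v i (X i)`.
  by_contra! hcon
  have h3 : (1 - ε) * v i Z ≤ (1 - ε) * ((1 + ε) * v i (X.bundle i)) :=
    mul_le_mul_of_nonneg_left (by linarith) (by linarith)
  nlinarith [(hv i).nonneg (X.bundle i), mul_nonneg (sq_nonneg ε) ((hv i).nonneg (X.bundle i))]

end Optimal

/-! ### Choosing representatives that contain a cycle -/

/-- First moment argument: let `V g` be sets of at most `d` elements, and let every `a` have a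
predecessor in each of them. If there are `k` sets and `k * (1 - 1 / d) ^ (k - 1) < 1`, then a
random choice of one element per set has positive probability that every chosen element has a chosen
predecessor. The membership of `x g` in `V g` is not needed later and not recorded. -/
lemma exists_representatives {K A : Type*} [Fintype K] [Nonempty A]
    {d : ℕ} (V : K → Finset A) (hV : ∀ g, (V g).card ≤ d) (pred : K → A → A)
    (hpred : ∀ g a, pred g a ∈ V g)
    (hk : Fintype.card K * (d - 1) ^ (Fintype.card K - 1) < d ^ (Fintype.card K - 1)) :
    ∃ x : K → A, ∀ j, ∃ g, pred g (x j) = x g := by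
  classical
  rcases isEmpty_or_nonempty K with hK | hK
  · exact ⟨fun g => hK.elim g, fun g => hK.elim g⟩
  obtain ⟨a₀⟩ := ‹Nonempty A›
  -- `e g` enumerates `V g` by `Fin d`, with repetitions; `idx g` picks an index of an element.
  have henum : ∀ g, ∃ e : Fin d → A, ∀ a ∈ V g, ∃ b, e b = a := fun g => by
    have hne : Nonempty (V g) := ⟨⟨_, hpred g a₀⟩⟩
    obtain ⟨φ⟩ : Nonempty (V g ↪ Fin d) :=
      Function.Embedding.nonempty_of_card_le (by simpa using hV g)
    refine ⟨fun b => (Function.invFun φ b : V g), fun a ha => ?_⟩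
    exact ⟨φ ⟨a, ha⟩, congrArg Subtype.val
      (Function.leftInverse_invFun φ.injective ⟨a, ha⟩)⟩
  choose e he using henum
  choose idx hidx using fun g a => he g (pred g a) (hpred g a)
  set k := Fintype.card K with hkdef
  have hkpos : 0 < k := Fintype.card_pos
  -- `bad j b` consists of the choices of `b` for `j` without a predecessor outside `j`.
  let bad : K → Fin d → Finset (K → Fin d) := fun j b =>
    Fintype.piFinset fun g => if g = j then {b} else univ \ {idx g (e j b)}
  have hbad : ∀ j b, (bad j b).card = (d - 1) ^ (k - 1) := fun j b => by
    rw [Fintype.card_piFinset, ← Finset.mul_prod_erase _ _ (mem_univ j)]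
    rw [Finset.prod_congr rfl (g := fun _ => d - 1) (fun g hg => by
      rw [if_neg (Finset.ne_of_mem_erase hg), card_sdiff_of_subset (subset_univ _)]; simp)]
    simp [hkdef, card_erase_of_mem]
  have hdpos : 0 < d := (idx (Classical.arbitrary K) a₀).pos
  have hcard : (univ.biUnion fun j => univ.biUnion (bad j)).card <
      (univ : Finset (K → Fin d)).card := by
    calc (univ.biUnion fun j => univ.biUnion (bad j)).card
        ≤ ∑ j, ∑ b, (bad j b).card :=
          card_biUnion_le.trans (Finset.sum_le_sum fun j _ => card_biUnion_le)
      _ = d * (k * (d - 1) ^ (k - 1)) := by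
          simp only [hbad, sum_const, card_univ, Fintype.card_fin, smul_eq_mul, ← hkdef]; ring
      _ < d * d ^ (k - 1) := Nat.mul_lt_mul_of_pos_left hk hdpos
      _ = (univ : Finset (K → Fin d)).card := by
          rw [← pow_succ', Nat.sub_add_cancel hkpos]; simp [hkdef]
  obtain ⟨y, -, hy⟩ := Finset.exists_mem_notMem_of_card_lt_card hcard
  refine ⟨fun g => e g (y g), fun j => ?_⟩
  by_contra! hno
  refine hy (mem_biUnion.2 ⟨j, mem_univ j, mem_biUnion.2 ⟨y j, mem_univ _, ?_⟩⟩)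
  refine Fintype.mem_piFinset.2 fun g => ?_
  by_cases hg : g = j
  · subst hg; simp
  · simp only [if_neg hg, mem_sdiff, mem_univ, mem_singleton, true_and]
    intro hgy
    exact hno g (by rw [hgy, hidx])

/-! ### Bounding the discarded goods -/

section Bounds

variable {N M : Type*} [DecidableEq M] [Fintype N] [Fintype M] {ε : ℝ} {v : N → Finset M → ℝ}
  {X : Allocation N M}

/-- The agents for whom a good `g` is valuable: it is worth more than `ε` times their bundle. -/
noncomputable def valuers (ε : ℝ) (v : N → Finset M → ℝ) (X : Allocation N M) (g : M) :
    Finset N :=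
  {i | ε * v i (X.bundle i) < v i {g}}

/-- The discarded goods of low demand are few: representatives of their sets of valuers, in which
every chosen agent is reached through the envy graph from a bundle that some chosen agent
champions, would give an improving cycle. -/
lemma IsOptimal.pow_le_of_low_demand [Nonempty N] (hX : IsOptimal (1 - ε) v X) (hε : 0 < ε)
    (hε' : ε ≤ 1) (hv : ∀ i, IsAdditive (v i)) {d : ℕ} {L : Finset M} (hL : L ⊆ X.discarded)
    (hd : ∀ g ∈ L, (valuers ε v X g).card ≤ d) (hne : L.Nonempty) :
    d ^ (L.card - 1) ≤ L.card * (d - 1) ^ (L.card - 1) := by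
  classical
  by_contra! hlt
  choose src hsrc hreach using hX.exists_source
  choose champ Z hZ hZlt hZs hval using fun (g : L) (s : N) (hs : ∀ j, ¬ Envy v X j s) =>
    hX.exists_champion hε hε' hv hs (hL g.2)
  obtain ⟨x, hx⟩ := exists_representatives (K := L) (fun g => valuers ε v X g)
    (fun g => hd g g.2) (fun g a => champ g (src a) (hsrc a))
    (fun g a => by simpa [valuers] using hval g (src a) (hsrc a)) (by simpa using hlt)
  obtain ⟨g₀, hg₀⟩ := hne
  let x' : M → N := fun g => if h : g ∈ L then x ⟨g, h⟩ else Classical.arbitrary N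
  have hx' : ∀ g : L, x' g = x g := fun g => by simp [x']
  choose φ hφ using hx
  obtain ⟨p, hp⟩ := exists_iterate_mem_periodicPts φ ⟨g₀, hg₀⟩
  -- `φ j` is a good whose representative champions the source of the representative of `j`. On the
  -- cycles of `φ` every good has the form `φ j`, so its representative has a bundle to move to.
  refine hX.not_exists_improving x'
    {a | ∃ j ∈ Function.periodicPts φ, ReflTransGen (Envy v X) a (x j)}
    ⟨_, _, hp, ReflTransGen.refl⟩ ?_
  rintro a ⟨j, hj, haj⟩
  rcases ReflTransGen.cases_head haj with rfl | ⟨b, hab, hbj⟩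
  · obtain ⟨i, hi, rfl⟩ := (Function.bijOn_periodicPts φ).surjOn hj
    refine ⟨src (x i), ⟨i, hi, hreach (x i)⟩, Z (φ i) (src (x i)) (hsrc _), ?_, ?_, hZs _ _ _⟩
    · refine (hZ (φ i) (src (x i)) (hsrc _)).trans (union_subset_union_right ?_)
      exact singleton_subset_iff.2 (mem_filter.2 ⟨hL (φ i).2, hx' _⟩)
    · rw [← hφ i]
      exact hZlt _ _ _
  · exact ⟨b, ⟨j, hj, hbj⟩, X.bundle b, subset_union_left, hab, hX.safe b⟩

/-- Discarded goods that are valuable to `i` are each worth more than `ε` times her bundle, while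
all discarded goods together are worth at most twice that bundle. -/
lemma IsOptimal.card_valuable_mul_le [DecidableEq N] (hX : IsOptimal (1 - ε) v X) (hε : 0 < ε)
    (hε' : ε ≤ 1 / 2) (hv : ∀ i, IsAdditive (v i)) (i : N) :
    (#{g ∈ X.discarded | i ∈ valuers ε v X g} : ℝ) * ε ≤ 2 := by
  set W := {g ∈ X.discarded | i ∈ valuers ε v X g} with hW
  have hWval : ∀ g ∈ W, ε * v i (X.bundle i) < v i {g} := fun g hg => by
    simpa [valuers] using (mem_filter.1 hg).2
  have hc := (hv i).nonneg (X.bundle i)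
  have hpool := hX.not_alphaEnvies_discarded (by linarith) hv i
  rw [AlphaEnvies, not_lt] at hpool
  have hpool' : v i X.discarded ≤ 2 * v i (X.bundle i) := by
    nlinarith [(hv i).nonneg X.discarded]
  have hsum : (#W : ℝ) * (ε * v i (X.bundle i)) ≤ v i W := by
    rw [(hv i).2 W, ← nsmul_eq_mul]
    exact Finset.card_nsmul_le_sum _ _ _ fun g hg => (hWval g hg).le
  have hWle : v i W ≤ v i X.discarded := (hv i).mono (filter_subset _ _)
  rcases hc.eq_or_lt with hc0 | hcpos
  · have hempty : W = ∅ := eq_empty_of_forall_notMem fun g hg => by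
      have h1 := hWval g hg
      have h2 : v i {g} ≤ v i W := (hv i).mono (singleton_subset_iff.2 hg)
      rw [← hc0] at h1 hpool'
      linarith
    simp [hempty]
  · refine le_of_mul_le_mul_right ?_ hcpos
    linarith

/-- Double counting the pairs of an agent and a discarded good that is valuable to her. -/
lemma IsOptimal.card_high_demand_le (hX : IsOptimal (1 - ε) v X) (hε : 0 < ε)
    (hε' : ε ≤ 1 / 2) (hv : ∀ i, IsAdditive (v i)) (d : ℕ) :
    (#{g ∈ X.discarded | d < (valuers ε v X g).card} : ℝ) * d ≤ Fintype.card N * (2 / ε) := by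
  classical
  have h1 : #{g ∈ X.discarded | d < (valuers ε v X g).card} * d ≤
      ∑ i : N, #{g ∈ X.discarded | i ∈ valuers ε v X g} := by
    calc #{g ∈ X.discarded | d < (valuers ε v X g).card} * d
        ≤ ∑ g ∈ X.discarded with d < (valuers ε v X g).card, (valuers ε v X g).card := by
          rw [← smul_eq_mul]
          exact card_nsmul_le_sum _ _ _ fun g hg => (mem_filter.1 hg).2.le
      _ ≤ ∑ g ∈ X.discarded, (valuers ε v X g).card :=
          sum_le_sum_of_subset (filter_subset _ _)
      _ = ∑ i : N, #{g ∈ X.discarded | i ∈ valuers ε v X g} := by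
          simp only [card_filter]
          rw [sum_comm]
          exact sum_congr rfl fun g _ => by simp
  calc (#{g ∈ X.discarded | d < (valuers ε v X g).card} : ℝ) * d
      ≤ ∑ i : N, (#{g ∈ X.discarded | i ∈ valuers ε v X g} : ℝ) := by exact_mod_cast h1
    _ ≤ ∑ _i : N, 2 / ε := sum_le_sum fun i _ =>
        (le_div_iff₀ hε).2 (hX.card_valuable_mul_le hε hε' hv i)
    _ = Fintype.card N * (2 / ε) := by simp

end Bounds

/-! ### Numerical estimates and the choice of the threshold -/

/-- The inequality says `1 ≤ k * (1 - 1 / d) ^ (k - 1)`; its right side is at most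
`k * exp (-(k - 1) / d)`. -/
lemma le_one_add_mul_log {d k : ℕ} (hd : 1 ≤ d) (hk : 1 ≤ k)
    (h : d ^ (k - 1) ≤ k * (d - 1) ^ (k - 1)) :
    (k : ℝ) ≤ 1 + 2 * d * Real.log (d + 1) := by
  have hd0 : (0 : ℝ) < d := by exact_mod_cast hd
  have hk0 : (0 : ℝ) < k := by exact_mod_cast hk
  have hcast : (d : ℝ) ^ (k - 1) ≤ k * ((d : ℝ) - 1) ^ (k - 1) := by
    have : ((d ^ (k - 1) : ℕ) : ℝ) ≤ ((k * (d - 1) ^ (k - 1) : ℕ) : ℝ) := by exact_mod_cast h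
    simpa [Nat.cast_sub hd] using this
  have hexp : (d : ℝ) - 1 ≤ d * Real.exp (-(1 / d)) := by
    have := mul_le_mul_of_nonneg_left (Real.add_one_le_exp (-(1 / (d : ℝ)))) hd0.le
    have h1 : (d : ℝ) * (-(1 / d) + 1) = d - 1 := by field_simp; ring
    linarith
  have hd1 : (0 : ℝ) ≤ (d : ℝ) - 1 := by
    have : (1 : ℝ) ≤ d := by exact_mod_cast hd
    linarith
  have hpow : (1 : ℝ) ≤ k * Real.exp (-((k - 1) / d)) := by
    have h1 := hcast.trans (mul_le_mul_of_nonneg_left (pow_le_pow_left₀ hd1 hexp (k - 1)) hk0.le)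
    rw [mul_pow, ← Real.exp_nat_mul, Nat.cast_sub hk] at h1
    have h2 : ((k : ℝ) - (1 : ℕ)) * -(1 / (d : ℝ)) = -((k - 1) / d) := by push_cast; ring
    rw [h2] at h1
    refine le_of_mul_le_mul_left ?_ (pow_pos hd0 (k - 1))
    linarith
  have hlog : (k : ℝ) - 1 ≤ d * Real.log k := by
    have h1 := Real.log_le_log one_pos hpow
    rw [Real.log_one, Real.log_mul hk0.ne' (Real.exp_pos _).ne', Real.log_exp] at h1
    have h2 : ((k : ℝ) - 1) / d ≤ Real.log k := by linarith
    rwa [div_le_iff₀' hd0] at h2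
  -- A crude bound on `k` comes from `log k ≤ √k`; it is then inserted into the logarithm.
  set y := Real.sqrt k with hy
  have hy0 : 0 < y := Real.sqrt_pos.2 hk0
  have hyk : y ^ 2 = k := Real.sq_sqrt hk0.le
  have hlogy : Real.log k ≤ y := by
    have h1 : y ≤ Real.exp (y / 2) := by
      have h2 := Real.add_one_le_exp (y / 4)
      have h3 : Real.exp (y / 2) = Real.exp (y / 4) ^ 2 := by
        rw [← Real.exp_nat_mul]; congr 1; push_cast; ring
      nlinarith [sq_nonneg (y / 4 - 1)]
    have h2 := (Real.log_le_iff_le_exp hy0).2 h1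
    rw [← hyk, Real.log_pow]
    push_cast
    linarith
  have hy1 : 1 ≤ y := Real.one_le_sqrt.2 (by exact_mod_cast hk)
  have hyd : y ≤ d + 1 := by
    have := mul_le_mul_of_nonneg_left hlogy hd0.le
    refine le_of_mul_le_mul_right ?_ hy0
    nlinarith
  have hlogd : Real.log k ≤ 2 * Real.log (d + 1) := by
    rw [← hyk, Real.log_pow]
    push_cast
    linarith [Real.log_le_log hy0 hyd]
  have := mul_le_mul_of_nonneg_left hlogd hd0.le
  linarith

section Bounds

variable {N M : Type*} [DecidableEq M] [Fintype N] [Fintype M] {ε : ℝ} {v : N → Finset M → ℝ}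
  {X : Allocation N M}

/-- With threshold `d ≈ √(n / log n)` there are `O(n / (ε * d))` discarded goods with more than `d`
valuers and `O(d * log d)` others. -/
lemma IsOptimal.card_discarded_le (hX : IsOptimal (1 - ε) v X) (hε : 0 < ε)
    (hε' : ε ≤ 1 / 2) (hv : ∀ i, IsAdditive (v i)) (hN : 2 ≤ Fintype.card N) :
    (#X.discarded : ℝ) ≤
      (9 + 2 / ε) * Real.sqrt (Fintype.card N * Real.log (Fintype.card N)) := by
  classical
  set n := Fintype.card N with hn
  have : Nonempty N := Fintype.card_pos_iff.1 (by omega)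
  have hn2 : (2 : ℝ) ≤ n := by exact_mod_cast hN
  set l := Real.log n with hl
  have hl2 : 1 / 2 ≤ l := by
    have h1 := Real.log_le_log two_pos hn2
    linarith [Real.log_two_gt_d9]
  have hln : l ≤ n := (Real.log_le_sub_one_of_pos (by linarith)).trans (by linarith)
  -- The threshold `d` between low and high demand balances `n / d` against `d * log n`.
  set q := Real.sqrt (n * l) with hq
  have hq2 : q ^ 2 = n * l := Real.sq_sqrt (by positivity)
  have hq1 : 1 ≤ q := Real.one_le_sqrt.2 (by nlinarith)
  have hlq : l ≤ q := Real.le_sqrt_of_sq_le (by nlinarith)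
  set d := ⌈q / l⌉₊ with hd
  have hl0 : 0 < l := by linarith
  have hd1 : 1 ≤ d := Nat.ceil_pos.2 (by positivity)
  have hdq : q ≤ d * l := (div_le_iff₀ hl0).1 (Nat.le_ceil _)
  have hdq' : d * l ≤ 2 * q := by
    have h1 := (Nat.ceil_lt_add_one (show 0 ≤ q / l by positivity)).le
    have h2 := mul_le_mul_of_nonneg_right h1 hl0.le
    rw [add_mul, div_mul_cancel₀ _ hl0.ne'] at h2
    linarith
  have hdn : d ≤ n := by
    refine Nat.ceil_le.2 ((div_le_iff₀ hl0).2 ?_)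
    nlinarith
  have hlogd : Real.log (d + 1) ≤ 2 * l := by
    have h1 : (d : ℝ) + 1 ≤ (n : ℝ) ^ 2 := by
      have : (d : ℝ) ≤ n := by exact_mod_cast hdn
      nlinarith
    have h2 := Real.log_le_log (by positivity) h1
    rw [Real.log_pow] at h2
    exact_mod_cast h2
  have hhigh : (#{g ∈ X.discarded | d < (valuers ε v X g).card} : ℝ) ≤ 2 / ε * q := by
    have h1 := hX.card_high_demand_le hε hε' hv d
    have hd0 : (0 : ℝ) < d := by exact_mod_cast hd1
    refine le_of_mul_le_mul_right (h1.trans ?_) hd0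
    have h2 : (n : ℝ) ≤ q * d := by
      refine le_of_mul_le_mul_right ?_ hl0
      nlinarith
    have h3 : 0 < 2 / ε := by positivity
    nlinarith
  have hlow : (#{g ∈ X.discarded | ¬ d < (valuers ε v X g).card} : ℝ) ≤ 9 * q := by
    set L := {g ∈ X.discarded | ¬ d < (valuers ε v X g).card} with hL
    rcases L.eq_empty_or_nonempty with h0 | hne
    · rw [h0]; simp; linarith
    · have h1 := le_one_add_mul_log hd1 hne.card_pos
        (hX.pow_le_of_low_demand hε (by linarith) hv (filter_subset _ _)
          (fun g hg => not_lt.1 (mem_filter.1 hg).2) hne)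
      have h2 : (d : ℝ) * Real.log (d + 1) ≤ d * (2 * l) :=
        mul_le_mul_of_nonneg_left hlogd (Nat.cast_nonneg d)
      linarith
  have hsplit := card_filter_add_card_filter_not (s := X.discarded)
    (fun g => d < (valuers ε v X g).card)
  have hsplit' : (#X.discarded : ℝ) = #{g ∈ X.discarded | d < (valuers ε v X g).card} +
      #{g ∈ X.discarded | ¬ d < (valuers ε v X g).card} := by exact_mod_cast hsplit.symm
  rw [hsplit']
  linarith

end Bounds

/-- A single agent can take all goods. -/
lemma exists_isEFX_of_subsingleton {N M : Type*} [DecidableEq M] [Fintype N] [Fintype M]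
    [Nonempty N] [Subsingleton N] {α : ℝ} (hα : α ≤ 1) {v : N → Finset M → ℝ}
    (hv : ∀ i, IsAdditive (v i)) :
    ∃ X : Allocation N M, X.IsEFX α v ∧ X.discarded = ∅ := by
  refine ⟨⟨fun _ => univ, fun i j hij => absurd (Subsingleton.elim i j) hij⟩, ?_, ?_⟩
  · intro i j g _ h
    have h1 := lt_of_alphaEnvies hα (hv i) h
    exact absurd ((hv i).mono (subset_univ (univ \ {g}))) h1.not_ge
  · ext g
    simp [Allocation.discarded]

end FairDivision

theorem mainTheorem3 (ε : ℝ) (hε : 0 < ε) (hε' : ε ≤ 1 / 2) :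
    ∃ C : ℝ, ∀ (n m : ℕ), 1 ≤ n →
      ∀ v : Fin n → Finset (Fin m) → ℝ, (∀ i, FairDivision.IsAdditive (v i)) →
        ∃ X : FairDivision.Allocation (Fin n) (Fin m),
          X.IsEFX (1 - ε) v ∧
          (X.discarded.card : ℝ) ≤ C * Real.sqrt ((n : ℝ) * Real.log (n : ℝ)) := by
  refine ⟨9 + 2 / ε, fun n m hn v hv => ?_⟩
  rcases hn.eq_or_lt with rfl | hn
  · -- For `n = 1` the bound is zero.
    obtain ⟨X, hX, h0⟩ := FairDivision.exists_isEFX_of_subsingleton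
      (show 1 - ε ≤ 1 by linarith) hv
    exact ⟨X, hX, by simp [h0]⟩
  · obtain ⟨X, hX⟩ := FairDivision.exists_isOptimal (1 - ε) v
    exact ⟨X, hX.efx, by simpa using hX.card_discarded_le hε hε' hv ((Fintype.card_fin n).symm ▸ hn)⟩
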